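/- Let $G$ be a countable group. The following conditions are equivalent. (i) $G$ belongs to the class $\mathcal A_1$ of countable groups that have a faithful, transitive, amenable f.s.o. action on a set. That is, $G$ has a faithful transitive action on a set $X$ such that there is a $G$-invariant mean on $\ell^\infty(X)$ and such that, for every $x\in X$, all the orbits in $X$ of the stabilizer $G_x$ of $x$ are finite. (ii) There exist an amenable Hausdorff locally compact group $\mathfrak G$ and an injective homomorphism $\rho : G\to \mathfrak G$ with dense range, such that $\mathfrak G$ has a compact open subgroup $H$ with trivial $G$-core: $\bigcap_{g\in G}\rho(g)H\rho(g)^{-1}=\{e\}$. (iii) There exist an amenable Hausdorff locally compact group $\mathfrak G$ and an injective homomorphism $\rho : G\to \mathfrak G$ with dense range, such that $\mathfrak G$ has a (continuous) proper, faithful action with finitely many orbits on a set $X$ (with the discrete topology). Here a mean on an algebra of functions is a unital positive linear functional. The group $\mathfrak G$ is amenable if there is a mean on the algebra $C_b(\mathfrak G)$ of bounded continuous complex-valued functions on $\mathfrak G$ that is invariant under left translations. The action on $X$ is proper if the map $\mathfrak G\times X\to X\times X$, $(g,x)\mapsto (gx,x)$, is proper. -/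

import Mathlib

universe u v₁ v₂ v₃ v₄

open scoped BoundedContinuousFunction ComplexOrder

namespace FSOAction

/-- `m` is a mean on the algebra `C_b(Z)` of bounded continuous complex-valued functions on `Z`:
a positive linear functional such that `m 1 = 1`. -/
structure IsMean {Z : Type*} [TopologicalSpace Z] (m : (Z →ᵇ ℂ) →ₗ[ℂ] ℂ) : Prop where
  map_one : m 1 = 1
  nonneg : ∀ f : Z →ᵇ ℂ, (∀ z, 0 ≤ f z) → 0 ≤ m f

/-- The translate `z ↦ f (g⁻¹ • z)` of a bounded continuous function `f`. -/
noncomputable def translate {G Z : Type*} [Group G] [TopologicalSpace Z] [MulAction G Z]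
    [ContinuousConstSMul G Z] (g : G) (f : Z →ᵇ ℂ) : Z →ᵇ ℂ :=
  f.compContinuous ⟨fun z => g⁻¹ • z, continuous_const_smul g⁻¹⟩

/-- The action of `G` on the space `Z` admits an invariant mean on `C_b(Z)`. -/
def HasInvariantMean (G Z : Type*) [Group G] [TopologicalSpace Z] [MulAction G Z]
    [ContinuousConstSMul G Z] : Prop :=
  ∃ m : (Z →ᵇ ℂ) →ₗ[ℂ] ℂ, IsMean m ∧ ∀ (g : G) (f : Z →ᵇ ℂ), m (translate g f) = m f

/-- A topological group is amenable if its action on itself by left translations admits an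
invariant mean on the bounded continuous functions. -/
def IsAmenableGroup (Γ : Type*) [Group Γ] [TopologicalSpace Γ] [IsTopologicalGroup Γ] : Prop :=
  HasInvariantMean Γ Γ

/-- An action on a set `X` is amenable if there is an invariant mean on `ℓ^∞(X)`, which is
`C_b(X)` for the discrete topology on `X`. -/
def IsAmenableAction (G X : Type*) [Group G] [MulAction G X] : Prop :=
  letI : TopologicalSpace X := ⊥
  haveI : DiscreteTopology X := ⟨rfl⟩
  haveI : ContinuousConstSMul G X := ⟨fun _ => continuous_of_discreteTopology⟩
  HasInvariantMean G X

/-- A topological group acts (continuously and) properly on a set `X` if the map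
`(g, x) ↦ (g • x, x)` is proper, where `X` has the discrete topology. -/
def IsProperAction (Γ X : Type*) [Group Γ] [TopologicalSpace Γ] [MulAction Γ X] : Prop :=
  letI : TopologicalSpace X := ⊥
  ProperSMul Γ X

/-- An action is f.s.o. (finite stabilizers orbits) if every stabilizer has finite orbits. -/
def IsFSO (G X : Type*) [Group G] [MulAction G X] : Prop :=
  ∀ x y : X, (MulAction.orbit (MulAction.stabilizer G x) y).Finite

/-- An action is almost transitive if it has finitely many orbits. -/
def IsAlmostTransitive (G X : Type*) [Group G] [MulAction G X] : Prop :=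
  Finite (MulAction.orbitRel.Quotient G X)

/-- The class of countable groups admitting a faithful, transitive, amenable f.s.o. action. -/
def InClassA₁ (G : Type u) [Group G] : Prop :=
  Countable G ∧
    ∃ (X : Type v₁) (_ : MulAction G X),
      FaithfulSMul G X ∧ MulAction.IsPretransitive G X ∧ IsAmenableAction G X ∧ IsFSO G X

/-- The `K`-core `⋂_{k ∈ K} k H k⁻¹` of `H`. -/
def relCore {Γ : Type*} [Group Γ] (K H : Subgroup Γ) : Subgroup Γ :=
  ⨅ k : K, H.map (MulAut.conj (k : Γ)).toMonoidHom

/-- `ρ` embeds the (abstract) group `G` densely in the topological group `Γ`. -/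
def IsDenseEmbedding {G Γ : Type*} [Group G] [Group Γ] [TopologicalSpace Γ] (ρ : G →* Γ) : Prop :=
  Function.Injective ρ ∧ DenseRange ρ

/-- `G` embeds densely in an amenable (Hausdorff) locally compact group that contains a compact
open subgroup with trivial `G`-core. -/
def EmbedsDenselyWithCompactOpen (G : Type u) [Group G] : Prop :=
  ∃ (Γ : Type v₂) (_ : Group Γ) (_ : TopologicalSpace Γ) (_ : IsTopologicalGroup Γ)
    (ρ : G →* Γ), T2Space Γ ∧ LocallyCompactSpace Γ ∧ IsAmenableGroup Γ ∧ IsDenseEmbedding ρ ∧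
      ∃ H : Subgroup Γ, IsOpen (H : Set Γ) ∧ IsCompact (H : Set Γ) ∧ relCore ρ.range H = ⊥

/-- `G` embeds densely in an amenable (Hausdorff) locally compact group that has a proper,
faithful and almost transitive action on a set. -/
def EmbedsDenselyWithProperAction (G : Type u) [Group G] : Prop :=
  ∃ (Γ : Type v₃) (_ : Group Γ) (_ : TopologicalSpace Γ) (_ : IsTopologicalGroup Γ)
    (ρ : G →* Γ), T2Space Γ ∧ LocallyCompactSpace Γ ∧ IsAmenableGroup Γ ∧ IsDenseEmbedding ρ ∧
      ∃ (X : Type v₄) (_ : MulAction Γ X),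
        IsProperAction Γ X ∧ FaithfulSMul Γ X ∧ IsAlmostTransitive Γ X

end FSOAction

namespace FSOAction

open MeasureTheory

/-! Given a faithful transitive f.s.o. action on `X`, let `Γ` be the closure of `G` in the
permutation group of `X`. Point stabilizers in `Γ` are open, and compact because the orbits of the
stabilizers in `G` are finite; the core of one stabilizer fixes every point, so it is trivial.
Conversely, `G` acts on the discrete space `Γ ⧸ H`: compactness of `H` gives f.s.o., and an
invariant mean pushes forward along `Γ → Γ ⧸ H`. For a proper, faithful, almost transitive action,
`H` is the intersection of the stabilizers of orbit representatives.

The hard point is amenability of the closure. Integrating over cosets of a stabilizer turns the mean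
on `X` into a `G`-invariant mean `M` on `C_b(Γ)` (`exists_mean_of_transitive`). Density alone does
not make `M` invariant under `Γ`, as translation need not be norm continuous on `C_b(Γ)`. So `M` is
composed with averaging over `H` (`isAmenableGroup_of_dense`). Translating by `γ` replaces `H` by `H
* γ`, up to a scalar. Both sets are finite unions of left cosets of one compact open subgroup;
density gives these cosets representatives in `G`, so `M` sees only the number of cosets, and
evaluation at `1` fixes the scalar. -/

/-- An invariant mean can be pushed forward along an equivariant continuous map. -/
theorem HasInvariantMean.map {G K Z Y : Type*} [Group G] [Group K] [TopologicalSpace Z]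
    [TopologicalSpace Y] [MulAction K Z] [ContinuousConstSMul K Z] [MulAction G Y]
    [ContinuousConstSMul G Y] (ρ : G →* K) (φ : C(Z, Y))
    (hφ : ∀ g z, φ (ρ g • z) = g • φ z) (h : HasInvariantMean K Z) : HasInvariantMean G Y := by
  obtain ⟨m, hm, hinv⟩ := h
  refine ⟨{ toFun := fun f => m (f.compContinuous φ)
            map_add' := fun f₁ f₂ => m.map_add (f₁.compContinuous φ) (f₂.compContinuous φ)
            map_smul' := fun c f => m.map_smul c (f.compContinuous φ) }, ⟨hm.map_one, ?_⟩, ?_⟩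
  · exact fun f hf => hm.nonneg _ fun z => hf _
  · intro g f
    refine Eq.trans ?_ (hinv (ρ g) (f.compContinuous φ))
    refine congrArg m ?_
    ext z
    have := hφ g⁻¹ z
    rw [map_inv] at this
    simp [translate, this]

theorem isAmenableAction_iff {G X : Type*} [Group G] [MulAction G X] [t : TopologicalSpace X]
    [d : DiscreteTopology X] [ContinuousConstSMul G X] :
    IsAmenableAction G X ↔ HasInvariantMean G X := by
  obtain rfl := d.eq_bot
  rfl

theorem setIntegral_preimage_mul_left {Γ : Type*} [Group Γ] [MeasurableSpace Γ] [MeasurableMul Γ]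
    (μ : Measure Γ) [μ.IsMulLeftInvariant] (g : Γ) (s : Set Γ)
    (f : Γ → ℂ) : ∫ u in (g * ·) ⁻¹' s, f (g * u) ∂μ = ∫ u in s, f u ∂μ :=
  (measurePreserving_mul_left μ g).setIntegral_preimage_emb (measurableEmbedding_mulLeft g) _ _

theorem exists_mem_of_denseRange {Γ G : Type*} [Group Γ] [TopologicalSpace Γ] [Group G]
    {ρ : G →* Γ} (hρ : DenseRange ρ) {s : Set Γ} (hs : IsOpen s) (hne : s.Nonempty) : ∃ g, ρ g ∈ s := by
  obtain ⟨_, hx, g, rfl⟩ := hρ.inter_open_nonempty s hs hne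
  exact ⟨g, hx⟩

/-- The right translate of a compact open set. -/
def mulRightCompactOpens {Γ : Type*} [Group Γ] [TopologicalSpace Γ] [IsTopologicalGroup Γ]
    (C : TopologicalSpace.CompactOpens Γ) (g : Γ) : TopologicalSpace.CompactOpens Γ :=
  C.map (· * g) (continuous_mul_const g) (isOpenMap_mul_right g)

theorem mem_mulRightCompactOpens {Γ : Type*} [Group Γ] [TopologicalSpace Γ] [IsTopologicalGroup Γ]
    {C : TopologicalSpace.CompactOpens Γ} {g x : Γ} :
    x ∈ mulRightCompactOpens C g ↔ x * g⁻¹ ∈ C := by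
  change x ∈ (· * g) '' (C : Set Γ) ↔ _
  simp

/-! ### Haar averages over compact open sets -/

section Averages

variable {Γ : Type*} [Group Γ] [TopologicalSpace Γ] [IsTopologicalGroup Γ]
  [MeasurableSpace Γ] [BorelSpace Γ]

/-- The function `x ↦ ∫ u in C, f (u⁻¹ * x)` for a compact open set `C`. -/
noncomputable def leftAverage (μ : Measure Γ) [IsFiniteMeasureOnCompacts μ]
    (C : TopologicalSpace.CompactOpens Γ) [T2Space Γ] : (Γ →ᵇ ℂ) →ₗ[ℂ] (Γ →ᵇ ℂ) where
  toFun f := BoundedContinuousFunction.ofNormedAddCommGroup (fun x => ∫ u in C, f (u⁻¹ * x) ∂μ)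
    (by
      -- Since `C` is clopen, the integrand cut off outside `C` is jointly continuous with compact
      -- support in `u`.
      have hcl : IsClopen (C : Set Γ) := ⟨C.isCompact.isClosed, C.isOpen⟩
      have h : Continuous (fun p : Γ × Γ =>
          Set.indicator (Prod.snd ⁻¹' (C : Set Γ)) (fun p => f (p.2⁻¹ * p.1)) p) :=
        Continuous.indicator (by simp [(hcl.preimage continuous_snd).frontier_eq]) (by fun_prop)
      have := continuousOn_integral_of_compact_support (μ := μ) (s := Set.univ)
        (f := fun x u => Set.indicator (C : Set Γ) (fun u => f (u⁻¹ * x)) u) C.isCompact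
        h.continuousOn (fun p x _ hx => Set.indicator_of_notMem hx _)
      simpa [integral_indicator C.isOpen.measurableSet, continuousOn_univ] using this)
    (‖f‖ * μ.real C)
    (fun x => norm_setIntegral_le_of_norm_le_const C.isCompact.measure_lt_top
      fun u _ => f.norm_coe_le_norm _)
  map_add' f₁ f₂ := by
    ext x
    refine integral_add ?_ ?_ <;>
    exact ContinuousOn.integrableOn_compact C.isCompact (by fun_prop)
  map_smul' c f := by
    ext x
    exact integral_const_mul c _

variable [T2Space Γ]

theorem leftAverage_apply (μ : Measure Γ) [IsFiniteMeasureOnCompacts μ]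
    (C : TopologicalSpace.CompactOpens Γ) (f : Γ →ᵇ ℂ) (x : Γ) :
    leftAverage μ C f x = ∫ u in C, f (u⁻¹ * x) ∂μ := rfl

theorem leftAverage_nonneg (μ : Measure Γ) [IsFiniteMeasureOnCompacts μ]
    (C : TopologicalSpace.CompactOpens Γ) (f : Γ →ᵇ ℂ) (hf : ∀ x, 0 ≤ f x) (x : Γ) :
    0 ≤ leftAverage μ C f x :=
  integral_nonneg fun _ => hf _

theorem leftAverage_one (μ : Measure Γ) [IsFiniteMeasureOnCompacts μ]
    (C : TopologicalSpace.CompactOpens Γ) : leftAverage μ C 1 = (μ.real C : ℂ) • 1 := by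
  ext x
  simp [leftAverage_apply]

variable {G : Type*} [Group G]

/-- If a compact open set `C` is a union of left cosets of `U`, its averages are sums of
translates of averages over `U` by elements of a dense subgroup. -/
theorem exists_leftAverage_eq_sum (μ : Measure Γ) [IsFiniteMeasureOnCompacts μ]
    [μ.IsMulLeftInvariant] {ρ : G →* Γ} (hρ : DenseRange ρ)
    (C D : TopologicalSpace.CompactOpens Γ) (U : Subgroup Γ) (hD : (D : Set Γ) = U)
    (hCU : ∀ c ∈ C, ∀ u ∈ U, c * u ∈ C) :
    ∃ T : Finset G, ∀ f, leftAverage μ C f = ∑ g ∈ T, translate (ρ g) (leftAverage μ D f) := by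
  classical
  have hU : IsOpen (U : Set Γ) := hD ▸ D.isOpen
  have := QuotientGroup.discreteTopology hU
  have hex : ∀ t : Γ ⧸ U, ∃ g : G, (ρ g : Γ ⧸ U) = t := fun t =>
    exists_mem_of_denseRange (s := QuotientGroup.mk ⁻¹' {t}) hρ
      ((isOpen_discrete _).preimage QuotientGroup.continuous_mk)
      ((Set.singleton_nonempty t).preimage QuotientGroup.mk_surjective)
  choose σ hσ using hex
  have hfin : ((QuotientGroup.mk : Γ → Γ ⧸ U) '' C).Finite :=
    (C.isCompact.image QuotientGroup.continuous_mk).finite_of_discrete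
  have hinj : Function.Injective σ := fun a b h => by rw [← hσ a, ← hσ b, h]
  refine ⟨hfin.toFinset.image σ, fun f => ?_⟩
  have hcoset : ∀ t : Γ ⧸ U,
      (QuotientGroup.mk : Γ → Γ ⧸ U) ⁻¹' {t} = ((ρ (σ t))⁻¹ * ·) ⁻¹' (U : Set Γ) := by
    intro t
    ext x
    conv_lhs => rw [← hσ t]
    simp [← QuotientGroup.eq, eq_comm]
  have hC : (C : Set Γ) = ⋃ t ∈ hfin.toFinset, (QuotientGroup.mk : Γ → Γ ⧸ U) ⁻¹' {t} := by
    ext x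
    simp only [Set.Finite.mem_toFinset, Set.mem_iUnion, Set.mem_preimage, Set.mem_singleton_iff,
      exists_prop, exists_eq_right', SetLike.mem_coe]
    refine ⟨fun hx => ⟨x, hx, rfl⟩, ?_⟩
    rintro ⟨y, hy, hyx⟩
    simpa using hCU y hy _ (QuotientGroup.eq.1 hyx)
  ext x
  rw [Finset.sum_image hinj.injOn, leftAverage_apply, BoundedContinuousFunction.coe_sum,
    Finset.sum_apply]
  have hsub : ∀ t ∈ hfin.toFinset, (QuotientGroup.mk : Γ → Γ ⧸ U) ⁻¹' {t} ⊆ C := by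
    intro t ht
    rw [hC]
    exact Set.subset_biUnion_of_mem (u := fun t => (QuotientGroup.mk : Γ → Γ ⧸ U) ⁻¹' {t}) ht
  generalize hfin.toFinset = S at hC hsub ⊢
  rw [hC, integral_biUnion_finset]
  · refine Finset.sum_congr rfl fun t _ => ?_
    simp only [translate, BoundedContinuousFunction.compContinuous_apply, ContinuousMap.coe_mk,
      leftAverage_apply, smul_eq_mul]
    rw [hcoset, hD, ← setIntegral_preimage_mul_left μ (ρ (σ t))⁻¹ U
      fun v => f (v⁻¹ * ((ρ (σ t))⁻¹ * x))]
    simp [mul_assoc]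
  · intro t _
    exact ((isOpen_discrete _).preimage QuotientGroup.continuous_mk).measurableSet
  · intro a _ b _ hab
    exact Disjoint.preimage _ (by simpa using hab)
  · intro t ht
    exact (ContinuousOn.integrableOn_compact C.isCompact (by fun_prop)).mono_set (hsub t ht)

/-- Substitute `v = u * g`: right translation carries Haar measure to a scalar multiple of itself.
The scalar `c` does not depend on `f`, so its value is never needed. -/
theorem exists_leftAverage_translate (μ : Measure Γ) [LocallyCompactSpace Γ] [μ.IsHaarMeasure]
    [μ.Regular] (C : TopologicalSpace.CompactOpens Γ) (g : Γ) :
    ∃ c : ℂ, ∀ f,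
      leftAverage μ C (translate g f) = c • leftAverage μ (mulRightCompactOpens C g) f := by
  have : (μ.map (· * g)).Regular := Measure.Regular.map (Homeomorph.mulRight g)
  have hμ := Measure.isMulLeftInvariant_eq_smul_of_regular (μ.map (· * g)) μ
  refine ⟨((μ.map (· * g)).haarScalarFactor μ : ℝ), fun f => ?_⟩
  ext x
  have h1 : ∫ u in (mulRightCompactOpens C g : Set Γ), f (u⁻¹ * x) ∂(μ.map (· * g))
      = ∫ u in C, f ((u * g)⁻¹ * x) ∂μ := by
    rw [setIntegral_map (TopologicalSpace.CompactOpens.isOpen _).measurableSet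
      (Continuous.aestronglyMeasurable (by fun_prop)) (by fun_prop)]
    congr 2
    ext u
    change u * g ∈ mulRightCompactOpens C g ↔ u ∈ C
    simp [mem_mulRightCompactOpens]
  rw [hμ] at h1
  simp only [leftAverage_apply, BoundedContinuousFunction.coe_smul, translate,
    BoundedContinuousFunction.compContinuous_apply, ContinuousMap.coe_mk, smul_eq_mul]
  simp only [mul_inv_rev, mul_assoc] at h1
  rw [← h1, Measure.restrict_smul, integral_smul_nnreal_measure]
  rfl

end Averages

/-- A mean on `C_b(Γ)` that is invariant under a dense subgroup can be averaged over a compact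
open subgroup to a mean that is invariant under `Γ`. -/
theorem isAmenableGroup_of_dense {Γ : Type*} [Group Γ] [TopologicalSpace Γ] [IsTopologicalGroup Γ]
    [T2Space Γ] {G : Type*} [Group G] {ρ : G →* Γ} (hρ : DenseRange ρ) (H : Subgroup Γ)
    (hHo : IsOpen (H : Set Γ)) (hHc : IsCompact (H : Set Γ)) (M : (Γ →ᵇ ℂ) →ₗ[ℂ] ℂ)
    (hM : IsMean M) (hinv : ∀ g f, M (translate (ρ g) f) = M f) : IsAmenableGroup Γ := by
  borelize Γ
  have : LocallyCompactSpace Γ :=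
    hHc.locallyCompactSpace_of_mem_nhds_of_group (hHo.mem_nhds H.one_mem)
  let K : TopologicalSpace.PositiveCompacts Γ :=
    ⟨⟨H, hHc⟩, by rw [hHo.interior_eq]; exact ⟨1, H.one_mem⟩⟩
  let μ : Measure Γ := Measure.haarMeasure K
  have hμH : μ H = 1 := Measure.haarMeasure_self (K₀ := K)
  let C : TopologicalSpace.CompactOpens Γ := ⟨⟨H, hHc⟩, hHo⟩
  have hC1 : leftAverage μ C 1 = 1 := by
    have : μ.real (C : Set Γ) = 1 := by simp [Measure.real, C, hμH]
    simp [leftAverage_one, this]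
  have key : ∀ (A D : TopologicalSpace.CompactOpens Γ) (U : Subgroup Γ), (D : Set Γ) = U →
      (∀ c ∈ A, ∀ u ∈ U, c * u ∈ A) →
      ∃ n : ℂ, ∀ f, M (leftAverage μ A f) = n * M (leftAverage μ D f) := by
    intro A D U hD hA
    obtain ⟨T, hT⟩ := exists_leftAverage_eq_sum μ hρ A D U hD hA
    exact ⟨T.card, fun f => by simp [hT, hinv]⟩
  refine ⟨M ∘ₗ leftAverage μ C, ⟨?_, ?_⟩, ?_⟩
  · rw [LinearMap.comp_apply, hC1, hM.map_one]
  · exact fun f hf => hM.nonneg _ (leftAverage_nonneg μ C f hf)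
  · intro γ f
    let C' := mulRightCompactOpens C γ
    -- Chosen so that both `H` and `H * γ` are stable under right multiplication by `U`.
    let U : Subgroup Γ := H ⊓ H.comap (MulAut.conj γ).toMonoidHom
    have hUo : IsOpen (U : Set Γ) := hHo.inter (hHo.preimage (by
      change Continuous fun x => γ * x * γ⁻¹
      fun_prop))
    have hUc : IsCompact (U : Set Γ) := hHc.of_isClosed_subset
      (Subgroup.isClosed_of_isOpen U hUo) inf_le_left
    let D : TopologicalSpace.CompactOpens Γ := ⟨⟨U, hUc⟩, hUo⟩
    obtain ⟨n, hn⟩ := key C D U rfl fun c hc u hu => H.mul_mem hc hu.1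
    obtain ⟨n', hn'⟩ := key C' D U rfl fun c hc u hu => by
      rw [mem_mulRightCompactOpens] at hc ⊢
      have := H.mul_mem hc hu.2
      simp only [MulEquiv.toMonoidHom_eq_coe, MonoidHom.coe_coe, MulAut.conj_apply] at this
      change c * u * γ⁻¹ ∈ H
      simpa [mul_assoc] using this
    obtain ⟨c, hc⟩ := exists_leftAverage_translate μ C γ
    have htr : translate γ (1 : Γ →ᵇ ℂ) = 1 := rfl
    have e1 := hn 1
    have e2 := hc 1
    rw [htr, hC1] at e2
    -- Testing on the constant function `1` compares the modular factor `c` with the coset counts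
    -- and yields `c * n' = n`.
    have e3 : c * (n' * M (leftAverage μ D 1)) = 1 := by
      rw [← hn', ← smul_eq_mul, ← map_smul, ← e2, hM.map_one]
    rw [hC1, hM.map_one] at e1
    simp only [LinearMap.comp_apply]
    rw [hc, map_smul, hn', hn, smul_eq_mul]
    have hD : M (leftAverage μ D 1) ≠ 0 := fun h => by simp [h] at e1
    have : c * n' = n := mul_right_cancel₀ hD (by rw [mul_assoc, e3, e1])
    rw [← this]; ring

/-- An invariant mean on a discrete transitive `Γ`-space with compact open stabilizers lifts
to `C_b(Γ)`. -/
theorem exists_mean_of_transitive {Γ X : Type*} [Group Γ] [TopologicalSpace Γ]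
    [IsTopologicalGroup Γ] [T2Space Γ] [MulAction Γ X] [TopologicalSpace X] [DiscreteTopology X]
    [MulAction.IsPretransitive Γ X] {G : Type*} [Group G] [MulAction G X]
    [ContinuousConstSMul G X] (ρ : G →* Γ) (hρ : ∀ g (x : X), ρ g • x = g • x) (x₀ : X)
    (hHo : IsOpen (MulAction.stabilizer Γ x₀ : Set Γ))
    (hHc : IsCompact (MulAction.stabilizer Γ x₀ : Set Γ)) (h : HasInvariantMean G X) :
    ∃ M : (Γ →ᵇ ℂ) →ₗ[ℂ] ℂ, IsMean M ∧ ∀ g f, M (translate (ρ g) f) = M f := by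
  obtain ⟨m, hm, hinv⟩ := h
  borelize Γ
  have : LocallyCompactSpace Γ :=
    hHc.locallyCompactSpace_of_mem_nhds_of_group (hHo.mem_nhds (Subgroup.one_mem _))
  set H := MulAction.stabilizer Γ x₀
  let K : TopologicalSpace.PositiveCompacts Γ :=
    ⟨⟨H, hHc⟩, by rw [hHo.interior_eq]; exact ⟨1, H.one_mem⟩⟩
  let μ : Measure Γ := Measure.haarMeasure K
  have hμH : μ.real H = 1 := by
    simp [Measure.real, show μ H = 1 from Measure.haarMeasure_self (K₀ := K)]
  choose s hs using fun x : X => MulAction.exists_smul_eq Γ x₀ x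
  let R : (Γ →ᵇ ℂ) →ₗ[ℂ] (X →ᵇ ℂ) :=
    { toFun := fun f => BoundedContinuousFunction.ofNormedAddCommGroup
        (fun x => ∫ k in H, f (s x * k) ∂μ) continuous_of_discreteTopology (‖f‖ * μ.real H)
        (fun x => norm_setIntegral_le_of_norm_le_const hHc.measure_lt_top
          fun u _ => f.norm_coe_le_norm _)
      map_add' := fun f₁ f₂ => by
        ext x
        refine integral_add ?_ ?_ <;>
        exact ContinuousOn.integrableOn_compact hHc (by fun_prop)
      map_smul' := fun c f => by
        ext x
        exact integral_const_mul c _ }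
  have hR : ∀ f x, R f x = ∫ k in H, f (s x * k) ∂μ := fun _ _ => rfl
  refine ⟨m ∘ₗ R, ⟨?_, ?_⟩, ?_⟩
  · have : R 1 = 1 := by
      ext x
      simp [hR, hμH]
    simp [this, hm.map_one]
  · exact fun f hf => hm.nonneg _ fun x => integral_nonneg fun _ => hf _
  · intro g f
    have : R (translate (ρ g) f) = translate g (R f) := by
      ext x
      simp only [hR, translate, BoundedContinuousFunction.compContinuous_apply,
        ContinuousMap.coe_mk, smul_eq_mul]
      set y := g⁻¹ • x
      -- The chosen section `s` is not equivariant; `k₀` is its defect, which lies in `H` and is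
      -- absorbed by left invariance of `μ`.
      let k₀ : Γ := (s y)⁻¹ * (ρ g)⁻¹ * s x
      have hk₀ : k₀ ∈ H := by
        rw [MulAction.mem_stabilizer_iff]
        simp only [k₀, mul_smul, hs, ← map_inv, hρ]
        rw [inv_smul_eq_iff, hs]
      have hint := setIntegral_preimage_mul_left μ k₀ H (fun k => f (s y * k))
      have hpre : (k₀ * ·) ⁻¹' (H : Set Γ) = H := by
        ext k
        exact H.mul_mem_cancel_left hk₀
      rw [hpre] at hint
      rw [← hint]
      simp [k₀, mul_assoc]
    simp only [LinearMap.comp_apply, this, hinv]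

/-! ### Cores, stabilizers and proper actions -/

theorem mem_relCore_range {G Γ : Type*} [Group G] [Group Γ] {ρ : G →* Γ} {H : Subgroup Γ}
    {γ : Γ} : γ ∈ relCore ρ.range H ↔ ∀ g, (ρ g)⁻¹ * γ * ρ g ∈ H := by
  simp only [relCore, Subgroup.mem_iInf, Subgroup.mem_map_equiv, Subtype.forall,
    MonoidHom.mem_range, forall_exists_index, forall_apply_eq_imp_iff, MulAut.conj_symm_apply]

/-- If the stabilizers are compact and open then the action on the discrete space is proper. -/
theorem isProperAction_of_stabilizer {Γ X : Type*} [Group Γ] [TopologicalSpace Γ]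
    [IsTopologicalGroup Γ] [MulAction Γ X]
    (ho : ∀ x : X, IsOpen (MulAction.stabilizer Γ x : Set Γ))
    (hc : ∀ x : X, IsCompact (MulAction.stabilizer Γ x : Set Γ)) : IsProperAction Γ X := by
  let t : TopologicalSpace X := ⊥
  have : DiscreteTopology X := ⟨rfl⟩
  change ProperSMul Γ X
  have hcont : Continuous fun p : Γ × X => p.1 • p.2 := by
    rw [continuous_prod_of_discrete_right]
    intro x
    refine ((IsLocallyConstant.iff_exists_open _).2 fun γ => ?_).continuous
    refine ⟨(γ⁻¹ * ·) ⁻¹' (MulAction.stabilizer Γ x : Set Γ),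
      (ho x).preimage (continuous_const_mul _), by simp, fun δ hδ => ?_⟩
    have : (γ⁻¹ * δ) • x = x := hδ
    rwa [mul_smul, inv_smul_eq_iff] at this
  refine ⟨isProperMap_iff_isCompact_preimage.2 ⟨hcont.prodMk continuous_snd, fun K hK => ?_⟩⟩
  have hfin := hK.finite_of_discrete
  have hpre : (fun p : Γ × X => (p.1 • p.2, p.2)) ⁻¹' K
      = ⋃ q ∈ K, {γ : Γ | γ • q.2 = q.1} ×ˢ {q.2} := by
    ext ⟨γ, x⟩
    simp only [Set.mem_preimage, Set.mem_iUnion, Set.mem_prod, Set.mem_ofPred_eq,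
      Set.mem_singleton_iff, exists_prop]
    constructor
    · exact fun h => ⟨_, h, rfl, rfl⟩
    · rintro ⟨⟨a, b⟩, h, h1, rfl⟩
      simpa [h1] using h
  rw [hpre]
  refine hfin.isCompact_biUnion fun q _ => IsCompact.prod ?_ isCompact_singleton
  obtain ⟨y, x⟩ := q
  by_cases hy : ∃ γ : Γ, γ • x = y
  · obtain ⟨γ, rfl⟩ := hy
    have : {δ : Γ | δ • x = γ • x} = (γ * ·) '' (MulAction.stabilizer Γ x : Set Γ) := by
      ext δ
      simp [mul_smul, inv_smul_eq_iff]
    rw [this]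
    exact (hc x).image (continuous_const_mul γ)
  · convert isCompact_empty
    ext δ
    simpa using fun h => hy ⟨δ, h⟩

theorem IsProperAction.isOpen_stabilizer {Γ X : Type*} [Group Γ] [TopologicalSpace Γ]
    [MulAction Γ X] (h : IsProperAction Γ X) (x : X) :
    IsOpen (MulAction.stabilizer Γ x : Set Γ) := by
  let t : TopologicalSpace X := ⊥
  have : DiscreteTopology X := ⟨rfl⟩
  have : ProperSMul Γ X := h
  exact (isOpen_discrete {x}).preimage (continuous_id.smul (continuous_const (y := x)))

theorem IsProperAction.isCompact_stabilizer {Γ X : Type*} [Group Γ] [TopologicalSpace Γ]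
    [MulAction Γ X] (h : IsProperAction Γ X) (x : X) :
    IsCompact (MulAction.stabilizer Γ x : Set Γ) := by
  let t : TopologicalSpace X := ⊥
  have : DiscreteTopology X := ⟨rfl⟩
  have : ProperSMul Γ X := h
  have hK := (ProperSMul.isProperMap_smul_pair (G := Γ) (X := X)).isCompact_preimage
    (isCompact_singleton (x := (x, x)))
  convert hK.image continuous_fst
  ext γ
  simp

/-! ### Transport of actions between universes -/

section Transport

variable {M : Type*} [Group M] {X : Type*} {Y : Type*} [MulAction M Y] (e : X ≃ Y)

theorem stabilizer_equiv_mulAction (x : X) :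
    letI := e.mulAction M
    MulAction.stabilizer M x = MulAction.stabilizer M (e x) := by
  let _ := e.mulAction M
  ext g
  simp [MulAction.mem_stabilizer_iff, e.smul_def, Equiv.symm_apply_eq]

theorem faithfulSMul_equiv_mulAction [FaithfulSMul M Y] :
    letI := e.mulAction M
    FaithfulSMul M X := by
  let _ := e.mulAction M
  refine ⟨fun {a b} h => FaithfulSMul.eq_of_smul_eq_smul fun y : Y => ?_⟩
  simpa [e.smul_def] using h (e.symm y)

theorem isPretransitive_equiv_mulAction [MulAction.IsPretransitive M Y] :
    letI := e.mulAction M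
    MulAction.IsPretransitive M X := by
  let _ := e.mulAction M
  refine ⟨fun x y => ?_⟩
  obtain ⟨g, hg⟩ := MulAction.exists_smul_eq M (e x) (e y)
  exact ⟨g, by simp [e.smul_def, hg]⟩

theorem isFSO_equiv_mulAction (h : IsFSO M Y) :
    letI := e.mulAction M
    IsFSO M X := by
  let _ := e.mulAction M
  intro x y
  refine ((h (e x) (e y)).preimage e.injective.injOn).subset ?_
  rintro _ ⟨⟨g, hg⟩, rfl⟩
  rw [stabilizer_equiv_mulAction e] at hg
  exact ⟨⟨g, hg⟩, by simp [Subgroup.smul_def, e.smul_def]⟩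

theorem isAmenableAction_equiv_mulAction (h : IsAmenableAction M Y) :
    letI := e.mulAction M
    IsAmenableAction M X := by
  let _ := e.mulAction M
  let _ : TopologicalSpace X := ⊥
  have : DiscreteTopology X := ⟨rfl⟩
  let _ : TopologicalSpace Y := ⊥
  have : DiscreteTopology Y := ⟨rfl⟩
  have : ContinuousConstSMul M X := ⟨fun _ => continuous_of_discreteTopology⟩
  have : ContinuousConstSMul M Y := ⟨fun _ => continuous_of_discreteTopology⟩
  exact isAmenableAction_iff.2 ((isAmenableAction_iff.1 h).map (MonoidHom.id M)
    ⟨e.symm, continuous_of_discreteTopology⟩ fun g z => by simp [e.smul_def])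

end Transport

theorem countable_of_isPretransitive (G X : Type*) [Group G] [Countable G] [MulAction G X]
    [MulAction.IsPretransitive G X] : Countable X := by
  rcases isEmpty_or_nonempty X with _ | ⟨⟨x⟩⟩
  · infer_instance
  · exact (MulAction.surjective_smul G x).countable

/-- Membership in the class does not depend on the universe of the set acted upon. -/
theorem InClassA₁.congr_universe {G : Type u} [Group G] (h : InClassA₁.{u, v₁} G) :
    InClassA₁.{u, v₂} G := by
  obtain ⟨hG, X, _, _, _, hA, hF⟩ := h
  have := countable_of_isPretransitive G X
  let e : Shrink.{v₂} X ≃ X := (equivShrink.{v₂} X).symm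
  exact ⟨hG, Shrink.{v₂} X, e.mulAction G, faithfulSMul_equiv_mulAction e,
    isPretransitive_equiv_mulAction e, isAmenableAction_equiv_mulAction e hA,
    isFSO_equiv_mulAction e hF⟩

/-! ### Coset spaces and intersections of stabilizers -/

theorem exists_mul_eq_of_denseRange {G Γ : Type*} [Group G] [Group Γ] [TopologicalSpace Γ]
    [IsTopologicalGroup Γ] {ρ : G →* Γ} (hρ : DenseRange ρ) {H : Subgroup Γ}
    (hH : IsOpen (H : Set Γ)) (γ : Γ) : ∃ g, ∃ h ∈ H, ρ g * h = γ := by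
  obtain ⟨g, hg⟩ := exists_mem_of_denseRange hρ (s := (fun x => x⁻¹ * γ) ⁻¹' (H : Set Γ))
    (hH.preimage (by fun_prop)) ⟨γ, by simp⟩
  exact ⟨g, _, hg, by simp⟩

theorem EmbedsDenselyWithCompactOpen.inClassA₁ {G : Type u} [Group G] [Countable G]
    (h : EmbedsDenselyWithCompactOpen.{u, v₂} G) : InClassA₁.{u, v₂} G := by
  obtain ⟨Γ, _, _, _, ρ, _, _, hA, ⟨hinj, hρ⟩, H, hHo, hHc, hcore⟩ := h
  have := QuotientGroup.discreteTopology hHo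
  let _ : MulAction G (Γ ⧸ H) := MulAction.compHom (Γ ⧸ H) ρ
  have hsmul : ∀ (g : G) (x : Γ ⧸ H), g • x = ρ g • x := fun _ _ => rfl
  have : ContinuousConstSMul G (Γ ⧸ H) := ⟨fun _ => continuous_of_discreteTopology⟩
  refine ⟨inferInstance, Γ ⧸ H, inferInstance, ⟨fun {a b} hab => ?_⟩, ⟨fun x y => ?_⟩, ?_, ?_⟩
  · have hmem : ρ (a⁻¹ * b) ∈ relCore ρ.range H := by
      refine mem_relCore_range.2 fun g => ?_
      have := hab (ρ g : Γ ⧸ H)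
      rw [hsmul, hsmul, MulAction.Quotient.smul_coe, MulAction.Quotient.smul_coe,
        QuotientGroup.eq] at this
      simpa [mul_assoc] using this
    rw [hcore, Subgroup.mem_bot, map_eq_one_iff ρ hinj, inv_mul_eq_one] at hmem
    exact hmem
  · obtain ⟨a, rfl⟩ := QuotientGroup.mk_surjective x
    obtain ⟨b, rfl⟩ := QuotientGroup.mk_surjective y
    obtain ⟨g, hg⟩ := exists_mem_of_denseRange hρ
      (s := (fun z => (z * a)⁻¹ * b) ⁻¹' (H : Set Γ)) (hHo.preimage (by fun_prop))
      ⟨b * a⁻¹, by simp⟩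
    exact ⟨g, QuotientGroup.eq.2 hg⟩
  · exact isAmenableAction_iff.2 (HasInvariantMean.map ρ
      ⟨QuotientGroup.mk, QuotientGroup.continuous_mk⟩ (fun _ _ => rfl) hA)
  · intro x y
    obtain ⟨a, rfl⟩ := QuotientGroup.mk_surjective x
    obtain ⟨b, rfl⟩ := QuotientGroup.mk_surjective y
    -- The stabilizer of `a H` in `Γ` is the compact group `a H a⁻¹`, so its orbits in the discrete
    -- coset space are finite.
    refine ((hHc.image (f := fun h => ((a * h * a⁻¹ * b : Γ) : Γ ⧸ H))
      (QuotientGroup.continuous_mk.comp (by fun_prop))).finite_of_discrete).subset ?_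
    rintro _ ⟨⟨g, hg⟩, rfl⟩
    have hg' : ((ρ g * a : Γ) : Γ ⧸ H) = a := hg
    refine ⟨a⁻¹ * ρ g * a, ?_, ?_⟩
    · have := QuotientGroup.eq.1 hg'.symm
      simpa [mul_assoc] using this
    · change _ = ((ρ g * b : Γ) : Γ ⧸ H)
      simp [mul_assoc]

theorem EmbedsDenselyWithCompactOpen.embedsDenselyWithProperAction {G : Type u} [Group G]
    [Countable G] (h : EmbedsDenselyWithCompactOpen.{u, v₃} G) :
    EmbedsDenselyWithProperAction.{u, v₃, v₄} G := by
  obtain ⟨Γ, _, _, _, ρ, hT, hL, hA, hρ, H, hHo, hHc, hcore⟩ := h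
  have hstab : ∀ a : Γ, (MulAction.stabilizer Γ (a : Γ ⧸ H) : Set Γ)
      = (fun x => a⁻¹ * x * a) ⁻¹' (H : Set Γ) := by
    intro a
    ext γ
    simp only [SetLike.mem_coe, MulAction.mem_stabilizer_iff, MulAction.Quotient.smul_coe,
      Set.mem_preimage]
    rw [eq_comm, QuotientGroup.eq, smul_eq_mul, mul_assoc]
  have : FaithfulSMul Γ (Γ ⧸ H) := by
    refine ⟨fun {a b} hab => ?_⟩
    have hmem : a⁻¹ * b ∈ relCore ρ.range H := by
      refine mem_relCore_range.2 fun g => ?_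
      have := hab (ρ g : Γ ⧸ H)
      rw [MulAction.Quotient.smul_coe, MulAction.Quotient.smul_coe, QuotientGroup.eq] at this
      simpa [mul_assoc] using this
    rwa [hcore, Subgroup.mem_bot, inv_mul_eq_one] at hmem
  have : Countable (Γ ⧸ H) := by
    refine Function.Surjective.countable (f := fun g : G => (ρ g : Γ ⧸ H)) fun x => ?_
    obtain ⟨a, rfl⟩ := QuotientGroup.mk_surjective x
    obtain ⟨g, h, hh, rfl⟩ := exists_mul_eq_of_denseRange hρ.2 hHo a
    exact ⟨g, QuotientGroup.eq.2 (by simpa using hh)⟩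
  let e : Shrink.{v₄} (Γ ⧸ H) ≃ Γ ⧸ H := (equivShrink.{v₄} _).symm
  let _ := e.mulAction Γ
  refine ⟨Γ, _, _, ‹_›, ρ, hT, hL, hA, hρ, Shrink.{v₄} (Γ ⧸ H), e.mulAction Γ,
    isProperAction_of_stabilizer (fun x => ?_) (fun x => ?_), faithfulSMul_equiv_mulAction e, ?_⟩
  · rw [stabilizer_equiv_mulAction e]
    obtain ⟨a, ha⟩ := QuotientGroup.mk_surjective (e x)
    rw [← ha, hstab]
    exact hHo.preimage (by fun_prop)
  · rw [stabilizer_equiv_mulAction e]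
    obtain ⟨a, ha⟩ := QuotientGroup.mk_surjective (e x)
    rw [← ha, hstab]
    convert hHc.image (f := fun x => a * x * a⁻¹) (by fun_prop)
    ext γ
    constructor
    · exact fun h => ⟨_, h, by simp [mul_assoc]⟩
    · rintro ⟨h, hh, rfl⟩
      simpa [mul_assoc] using hh
  · have := isPretransitive_equiv_mulAction (M := Γ) e
    have := (MulAction.pretransitive_iff_subsingleton_quotient Γ (Shrink.{v₄} (Γ ⧸ H))).1 this
    exact Finite.of_subsingleton

theorem EmbedsDenselyWithProperAction.embedsDenselyWithCompactOpen {G : Type u} [Group G]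
    (h : EmbedsDenselyWithProperAction.{u, v₃, v₄} G) :
    EmbedsDenselyWithCompactOpen.{u, v₃} G := by
  obtain ⟨Γ, _, _, _, ρ, hT, hL, hA, hρ, X, _, hP, hF, hQ⟩ := h
  have : Finite (MulAction.orbitRel.Quotient Γ X) := hQ
  let r : MulAction.orbitRel.Quotient Γ X → X := Quotient.out
  have hfaith : ∀ γ : Γ, (∀ x : X, γ • x = x) → γ = 1 := fun γ h =>
    FaithfulSMul.eq_of_smul_eq_smul fun x : X => by rw [h, one_smul]
  let H : Subgroup Γ := ⨅ q, MulAction.stabilizer Γ (r q)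
  have hHset : (H : Set Γ) = ⋂ q, (MulAction.stabilizer Γ (r q) : Set Γ) := Subgroup.coe_iInf
  have hHo : IsOpen (H : Set Γ) := by
    rw [hHset]
    exact isOpen_iInter_of_finite fun q => hP.isOpen_stabilizer _
  refine ⟨Γ, _, _, ‹_›, ρ, hT, hL, hA, hρ, H, hHo, ?_, ?_⟩
  · rcases isEmpty_or_nonempty (MulAction.orbitRel.Quotient Γ X) with hE | ⟨⟨q⟩⟩
    -- With no orbits the intersection is all of `Γ`, which is trivial by faithfulness.
    · have hX : IsEmpty X := ⟨fun x => hE.false (Quotient.mk _ x)⟩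
      have : Subsingleton Γ :=
        ⟨fun a b => FaithfulSMul.eq_of_smul_eq_smul fun x : X => hX.elim x⟩
      exact (Set.subsingleton_of_subsingleton).isCompact
    · exact (hP.isCompact_stabilizer (r q)).of_isClosed_subset
        (Subgroup.isClosed_of_isOpen H hHo) (hHset ▸ Set.iInter_subset _ q)
  · rw [eq_bot_iff]
    intro γ hγ
    rw [Subgroup.mem_bot]
    refine hfaith γ fun x => ?_
    obtain ⟨δ, hδ⟩ : ∃ δ : Γ, δ • r (Quotient.mk _ x) = x := by
      obtain ⟨δ, hδ⟩ := Quotient.mk_out (s := MulAction.orbitRel Γ X) x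
      exact ⟨δ⁻¹, inv_smul_eq_iff.2 hδ.symm⟩
    -- As `H` fixes every representative, `δ` may be replaced by an element of `G`; hence the
    -- `G`-core, and not only the `Γ`-core, fixes `x`.
    obtain ⟨g, h, hh, rfl⟩ := exists_mul_eq_of_denseRange hρ.2 hHo δ
    have hfix : ∀ k ∈ H, k • r (Quotient.mk _ x) = r (Quotient.mk _ x) := fun k hk =>
      (Subgroup.mem_iInf.1 hk (Quotient.mk _ x) :)
    rw [mul_smul, hfix h hh] at hδ
    have := hfix _ (mem_relCore_range.1 hγ g)
    rwa [mul_smul, mul_smul, inv_smul_eq_iff, hδ] at this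

/-! ### Pointwise convergence on self-maps and permutations -/

section End

variable (X : Type*)

/-- The topology of pointwise convergence on the monoid of self-maps of a set. -/
instance : TopologicalSpace (Function.End X) :=
  Pi.topologicalSpace (Y := fun _ : X => X) (t₂ := fun _ => ⊥)

variable {X}

theorem continuous_end_apply [t : TopologicalSpace X] [d : DiscreteTopology X] (x : X) :
    Continuous fun σ : Function.End X => σ x := by
  obtain rfl := d.eq_bot
  exact @continuous_apply X (fun _ => X) (fun _ => ⊥) x

theorem continuous_end_iff {Z : Type*} [TopologicalSpace Z] [t : TopologicalSpace X]
    [d : DiscreteTopology X] {f : Z → Function.End X} :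
    Continuous f ↔ ∀ x, Continuous fun z => f z x := by
  obtain rfl := d.eq_bot
  exact @continuous_pi_iff Z X (fun _ => X) _ (fun _ => ⊥) f

instance : T2Space (Function.End X) := by
  let _ : TopologicalSpace X := ⊥
  have : DiscreteTopology X := ⟨rfl⟩
  exact inferInstanceAs (T2Space (X → X))

instance : ContinuousMul (Function.End X) := by
  let _ : TopologicalSpace X := ⊥
  have : DiscreteTopology X := ⟨rfl⟩
  refine ⟨continuous_end_iff.2 fun x => ?_⟩
  have h1 : Continuous fun p : Function.End X × X => p.1 p.2 :=
    continuous_prod_of_discrete_right.2 continuous_end_apply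
  exact h1.comp (continuous_fst.prodMk ((continuous_end_apply x).comp continuous_snd))

theorem isCompact_end_pi {F : X → Set X} (hF : ∀ x, (F x).Finite) :
    IsCompact {σ : Function.End X | ∀ x, σ x ∈ F x} := by
  let _ : TopologicalSpace X := ⊥
  exact isCompact_pi_infinite fun x => (hF x).isCompact

theorem continuous_units_end_apply [TopologicalSpace X] [DiscreteTopology X] (x : X) :
    Continuous fun σ : (Function.End X)ˣ => σ • x :=
  (continuous_end_apply x).comp Units.continuous_val

/-- The unit group is closed in `End × Endᵐᵒᵖ` via `σ ↦ (σ, σ⁻¹)`, so Tychonoff applies once both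
`σ` and `σ⁻¹` are confined to finite sets pointwise. -/
theorem isCompact_units_end {S : Set (Function.End X)ˣ} (hS : IsClosed S) {F : X → Set X}
    (hF : ∀ x, (F x).Finite) (h : ∀ σ ∈ S, ∀ x, σ • x ∈ F x)
    (h' : ∀ σ ∈ S, ∀ x, σ⁻¹ • x ∈ F x) : IsCompact S := by
  have hK := isCompact_end_pi hF
  refine (Units.isClosedEmbedding_embedProduct.isCompact_preimage
    (hK.prod (hK.image MulOpposite.continuous_op))).of_isClosed_subset hS ?_
  intro σ hσ
  exact ⟨h σ hσ, ⟨_, h' σ hσ, rfl⟩⟩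

end End

/-! ### The closure of `G` in the permutation group -/

section Completion

variable (G X : Type*) [Group G] [MulAction G X]

/-- The closure of the image of `G` in the group of permutations of `X`. -/
def permClosure : Subgroup (Function.End X)ˣ :=
  (MulAction.toEndHom (M := G) (α := X)).toHomUnits.range.topologicalClosure

/-- The homomorphism from `G` to its closure in the group of permutations of `X`. -/
def toPermClosure : G →* permClosure G X :=
  (MulAction.toEndHom (M := G) (α := X)).toHomUnits.codRestrict _
    fun g => Subgroup.le_topologicalClosure _ ⟨g, rfl⟩

variable {G X}

theorem toPermClosure_smul (g : G) (x : X) : toPermClosure G X g • x = g • x := rfl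

theorem denseRange_toPermClosure : DenseRange (toPermClosure G X) := by
  rw [DenseRange, Subtype.dense_iff]
  intro σ hσ
  have : Subtype.val '' Set.range (toPermClosure G X)
      = ((MulAction.toEndHom (M := G) (α := X)).toHomUnits.range : Set (Function.End X)ˣ) := by
    ext τ
    constructor
    · rintro ⟨_, ⟨g, rfl⟩, rfl⟩
      exact ⟨g, rfl⟩
    · rintro ⟨g, rfl⟩
      exact ⟨_, ⟨g, rfl⟩, rfl⟩
  exact this ▸ hσ

theorem eq_one_of_smul_eq {σ : permClosure G X} (h : ∀ x : X, σ • x = x) : σ = 1 :=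
  Subtype.ext (Units.ext (funext h))

theorem continuous_permClosure_smul [TopologicalSpace X] [DiscreteTopology X] (x : X) :
    Continuous fun σ : permClosure G X => σ • x :=
  (continuous_units_end_apply x).comp continuous_subtype_val

theorem isOpen_stabilizer_permClosure (x : X) :
    IsOpen (MulAction.stabilizer (permClosure G X) x : Set (permClosure G X)) := by
  let _ : TopologicalSpace X := ⊥
  have : DiscreteTopology X := ⟨rfl⟩
  exact (isOpen_discrete {x}).preimage (continuous_permClosure_smul x)

/-- By density some `g` in `G` agrees with `σ` at both `x` and `y`. Thus passing to the closure does
not enlarge stabilizer orbits. -/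
theorem smul_mem_orbit_stabilizer {σ : permClosure G X} {x : X}
    (hσ : σ ∈ MulAction.stabilizer (permClosure G X) x) (y : X) :
    σ • y ∈ MulAction.orbit (MulAction.stabilizer G x) y := by
  let _ : TopologicalSpace X := ⊥
  have : DiscreteTopology X := ⟨rfl⟩
  obtain ⟨g, hg⟩ := exists_mem_of_denseRange (denseRange_toPermClosure (G := G) (X := X))
    (((isOpen_discrete {x}).preimage (continuous_permClosure_smul x)).inter
      ((isOpen_discrete {σ • y}).preimage (continuous_permClosure_smul y))) ⟨σ, hσ, rfl⟩
  exact ⟨⟨g, hg.1⟩, hg.2⟩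

theorem isCompact_stabilizer_permClosure (hG : IsFSO G X) (x : X) :
    IsCompact (MulAction.stabilizer (permClosure G X) x : Set (permClosure G X)) := by
  have hcl : IsClosed (permClosure G X : Set (Function.End X)ˣ) :=
    Subgroup.isClosed_topologicalClosure _
  have hst := Subgroup.isClosed_of_isOpen _ (isOpen_stabilizer_permClosure (G := G) x)
  rw [Subtype.isCompact_iff]
  refine isCompact_units_end (hcl.isClosedEmbedding_subtypeVal.isClosedMap _ hst) (hG x) ?_ ?_
  · rintro _ ⟨σ, hσ, rfl⟩ y
    exact smul_mem_orbit_stabilizer hσ y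
  · rintro _ ⟨σ, hσ, rfl⟩ y
    exact smul_mem_orbit_stabilizer (inv_mem hσ) y

end Completion

theorem InClassA₁.embedsDenselyWithCompactOpen {G : Type u} [Group G]
    (h : InClassA₁.{u, v₂} G) : EmbedsDenselyWithCompactOpen.{u, v₂} G := by
  obtain ⟨-, X, _, hf, ht, hA, hF⟩ := h
  let _ : TopologicalSpace X := ⊥
  have : DiscreteTopology X := ⟨rfl⟩
  have : ContinuousConstSMul G X := ⟨fun _ => continuous_of_discreteTopology⟩
  have hA := isAmenableAction_iff.1 hA
  -- On an empty set `1 = 0`, so no mean exists.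
  have hX : Nonempty X := by
    by_contra hX
    rw [not_nonempty_iff] at hX
    obtain ⟨m, hm, -⟩ := hA
    have h1 := hm.map_one
    rw [show (1 : X →ᵇ ℂ) = 0 from BoundedContinuousFunction.ext fun x => hX.elim x,
      map_zero] at h1
    exact zero_ne_one h1
  obtain ⟨x₀⟩ := hX
  have hpre : MulAction.IsPretransitive (permClosure G X) X := ⟨fun x y => by
    obtain ⟨g, hg⟩ := MulAction.exists_smul_eq G x y
    exact ⟨toPermClosure G X g, hg⟩⟩
  have hHo := isOpen_stabilizer_permClosure (G := G) x₀
  have hHc := isCompact_stabilizer_permClosure hF x₀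
  obtain ⟨M, hM, hinv⟩ :=
    exists_mean_of_transitive (toPermClosure G X) toPermClosure_smul x₀ hHo hHc hA
  refine ⟨permClosure G X, inferInstance, inferInstance, inferInstance, toPermClosure G X,
    inferInstance,
    hHc.locallyCompactSpace_of_mem_nhds_of_group (hHo.mem_nhds (Subgroup.one_mem _)),
    isAmenableGroup_of_dense denseRange_toPermClosure _ hHo hHc M hM hinv,
    ⟨fun a b hab => FaithfulSMul.eq_of_smul_eq_smul fun x : X => ?_, denseRange_toPermClosure⟩,
    _, hHo, hHc, ?_⟩
  · rw [← toPermClosure_smul, hab, toPermClosure_smul]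
  · rw [eq_bot_iff]
    intro σ hσ
    refine eq_one_of_smul_eq fun x => ?_
    obtain ⟨g, rfl⟩ := MulAction.exists_smul_eq G x₀ x
    have := MulAction.mem_stabilizer_iff.1 (mem_relCore_range.1 hσ g)
    rwa [mul_smul, mul_smul, inv_smul_eq_iff, toPermClosure_smul] at this

end FSOAction

theorem proposition5p1 (G : Type u) [Group G] [Countable G] :
    List.TFAE
      [FSOAction.InClassA₁.{u, v₁} G,
       FSOAction.EmbedsDenselyWithCompactOpen.{u, v₂} G,
       FSOAction.EmbedsDenselyWithProperAction.{u, v₃, v₄} G] := by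
  tfae_have 1 → 2 := fun h => h.congr_universe.embedsDenselyWithCompactOpen
  -- The detour through the class changes the universe of the topological group: the countable set
  -- acted upon is shrunk and the group is rebuilt as a closure.
  tfae_have 2 → 3 := fun h =>
    h.inClassA₁.congr_universe.embedsDenselyWithCompactOpen.embedsDenselyWithProperAction
  tfae_have 3 → 1 := fun h => h.embedsDenselyWithCompactOpen.inClassA₁.congr_universe
  tfae_finish
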